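/- Let $a_0,a_1,a_2$ be the vertices of a nondegenerate triangle in $\mathbb{R}^2$, let $V_0=\{a_0,a_1,a_2\}$, and let $G_0$ be the complete graph on $V_0$. Put $\Psi_i(x)=\tfrac12(x-a_i)+a_i$ for $i\in\{0,1,2\}$, let $G_N=(V_N,E_N)=\bigcup_{i=0}^{2}\Psi_i(G_{N-1})$ for $N\ge 1$, and give every edge of $G_N$ conductance $1$. Two vertices $x,y\in V_N$ are in the same level-$j$ cell ($0\le j\le N$) if there is a word $w=w_1\cdots w_j\in\{0,1,2\}^j$ with $x,y\in\Psi_{w_1}\circ\cdots\circ\Psi_{w_j}(V_0)$. For $\alpha\in[0,1]$ let $\nu_\alpha$ be the product Bernoulli measure on $\{0,1\}^{V_N}$ with $\nu_\alpha\{\zeta:\zeta(z)=1\}=\alpha$ for all $z\in V_N$, and write $\nu_\alpha[h]=\int h\,d\nu_\alpha$. For $f:\{0,1\}^{V_N}\to\mathbb{R}$ and $x,y\in V_N$ put $(\nabla_{xy}f)(\zeta)=f(\zeta^{xy})-f(\zeta)$, where $\zeta^{xy}$ is $\zeta$ with the values at $x$ and $y$ exchanged, and let $$\mathcal{E}^{\mathrm{EX}}_{(G_N,\mathbf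 1),\nu_\alpha}(f)=\nu_\alpha\Big[f\cdot\Big(-\sum_{zw\in E_N}\nabla_{zw}f\Big)\Big]$$ (each undirected edge is counted once) be the Dirichlet energy of the symmetric exclusion process on $(G_N,\mathbf 1)$. **Proposition 1.3 (Moving particle lemma on $SG$).** There exists a constant $C>0$, independent of $N$ and $j$, such that for all integers $0\le j\le N$, all $\alpha\in[0,1]$, all $x,y\in V_N$ in the same level-$j$ cell, and all $f:\{0,1\}^{V_N}\to\mathbb{R}$, $$\nu_\alpha\big[(\nabla_{xy}f)^2\big]\le C\left(\tfrac53\right)^{N-j}\mathcal{E}^{\mathrm{EX}}_{(G_N,\mathbf 1),\nu_\alpha}(f).$$ -/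

import Mathlib

open MeasureTheory

noncomputable section

/-! ### The symmetric exclusion process on a finite weighted graph -/

namespace Exclusion

variable {V : Type*}

/-- Configurations: elements of `{0,1}^V`; `ζ z = 1` means that `z` is occupied. -/
abbrev Config (V : Type*) : Type _ := V → Fin 2

open Classical in
/-- The configuration `ζ^{xy}`, in which the values of `ζ` at `x` and `y` are exchanged. -/
def exchange (x y : V) (ζ : Config V) : Config V := fun z =>
  if z = x then ζ y else if z = y then ζ x else ζ z

theorem exchange_comm (x y : V) (ζ : Config V) : exchange x y ζ = exchange y x ζ := by
  funext z
  unfold exchange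
  split_ifs <;> simp_all

/-- The discrete gradient `(∇_{xy} f)(ζ) = f(ζ^{xy}) - f(ζ)`. -/
def grad (x y : V) (f : Config V → ℝ) (ζ : Config V) : ℝ := f (exchange x y ζ) - f ζ

/-- The discrete gradient `∇_e f` along an unordered pair `e = xy`. -/
def edgeGrad (e : Sym2 V) (f : Config V → ℝ) : Config V → ℝ :=
  Sym2.lift ⟨fun x y => grad x y f, fun x y => by
    funext ζ; simp only [grad, exchange_comm x y]⟩ e

open Classical in
/-- The generator `(L f)(ζ) = ∑_{xy ∈ E} c_{xy} (∇_{xy} f)(ζ)` of the symmetric exclusion process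
on `(G, c)`; the sum runs over unordered edges. -/
def generator [Fintype V] (G : SimpleGraph V) (c : Sym2 V → ℝ) (f : Config V → ℝ)
    (ζ : Config V) : ℝ :=
  ∑ e ∈ G.edgeFinset, c e * edgeGrad e f ζ

/-- The product Bernoulli measure `ν_α` on `{0,1}^V`: the coordinates are independent, equal to `1`
with probability `α` and to `0` with probability `1 - α`. -/
def bernoulliProduct (V : Type*) [Fintype V] (α : unitInterval) : Measure (Config V) :=
  Measure.pi fun _ : V => ProbabilityTheory.bernoulliMeasure (1 : Fin 2) (0 : Fin 2) α

/-- The Dirichlet energy `ν_α[f (-L f)]` of the symmetric exclusion process on `(G, c)`. -/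
def dirichletEnergy [Fintype V] (G : SimpleGraph V) (c : Sym2 V → ℝ) (α : unitInterval)
    (f : Config V → ℝ) : ℝ :=
  ∫ ζ, f ζ * (-generator G c f ζ) ∂(bernoulliProduct V α)

end Exclusion

/-! ### The Sierpinski gasket graphs -/

namespace SierpinskiGasket

/-- The Euclidean plane. -/
abbrev Plane : Type := EuclideanSpace ℝ (Fin 2)

/-- The contracting similitude `Ψ_i(x) = (x - a_i) / 2 + a_i`. -/
def contraction (a : Fin 3 → Plane) (i : Fin 3) (x : Plane) : Plane :=
  (1 / 2 : ℝ) • (x - a i) + a i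

theorem contraction_injective (a : Fin 3 → Plane) (i : Fin 3) :
    Function.Injective (contraction a i) := by
  intro x y h
  simpa [contraction] using h

/-- `Ψ_i` as a map of the complete graph on the plane to itself, so that it acts on subgraphs. -/
def contractionHom (a : Fin 3 → Plane) (i : Fin 3) :
    (⊤ : SimpleGraph Plane) →g (⊤ : SimpleGraph Plane) where
  toFun := contraction a i
  map_rel' := fun {_ _} h => (contraction_injective a i).ne h

/-- The Sierpinski gasket graph `G_N = (V_N, E_N)`, as a graph drawn on points of the plane:
`G_0` is the complete graph on `V_0 = {a_0, a_1, a_2}`, and `G_{N+1} = ⋃_i Ψ_i(G_N)`. -/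
def graph (a : Fin 3 → Plane) : ℕ → (⊤ : SimpleGraph Plane).Subgraph
  | 0 => (⊤ : (⊤ : SimpleGraph Plane).Subgraph).induce (Set.range a)
  | N + 1 => ⨆ i : Fin 3, (graph a N).map (contractionHom a i)

theorem finite_verts (a : Fin 3 → Plane) (N : ℕ) : (graph a N).verts.Finite := by
  induction N with
  | zero => exact Set.finite_range a
  | succ N ih =>
    simp only [graph, SimpleGraph.Subgraph.verts_iSup, SimpleGraph.Subgraph.map_verts]
    exact Set.finite_iUnion fun i => ih.image _

instance (a : Fin 3 → Plane) (N : ℕ) : Fintype (graph a N).verts := (finite_verts a N).fintype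

/-- `Ψ_w = Ψ_{w_1} ∘ ⋯ ∘ Ψ_{w_m}` for a word `w = w_1 ⋯ w_m` over `{0,1,2}`. -/
def wordMap (a : Fin 3 → Plane) (w : List (Fin 3)) : Plane → Plane :=
  w.foldr (fun i g => contraction a i ∘ g) id

/-- `x` and `y` are in the same level-`j` cell: both belong to `Ψ_w(V_0)` for a single word `w` of
length `j`. -/
def SameCell (a : Fin 3 → Plane) (j : ℕ) (x y : Plane) : Prop :=
  ∃ w : List (Fin 3), w.length = j ∧
    x ∈ wordMap a w '' Set.range a ∧ y ∈ wordMap a w '' Set.range a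

end SierpinskiGasket

end

noncomputable section

/-! ### Exchanges, Bernoulli averages and the Dirichlet energy. -/

namespace Exclusion

variable {V : Type*}

/-! Since `ν_α` is invariant under exchanges, the Dirichlet energy is half the sum over edges of the
mean square gradients. It therefore suffices to compare sums of mean square gradients over the
level-`j` cells with those over the level-`N` cells.

For an electric network, subdividing a triangle once and eliminating the three midpoints by
star-mesh transforms gives back the triangle with conductances `3/5`. For exclusion each elimination
becomes an inequality (`starMesh`), and the inequality goes in the useful direction: energy is only
lost. Averaging over a star's five sites with the others frozen reduces it to a quadratic form that
splits by particle number. One particle gives a perfect square, two particles an explicit sum of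
squares, and particle-hole symmetry gives the remaining sectors. Only three conductance vectors
occur.

The resulting `three_fifths_triangle_le`, applied in every cell, bounds the level-`M` sum by `5/3`
times the level-`(M+1)` sum. Iterating up to level `N`, where cell edges are exactly graph edges,
gives the factor `(5/3)^(N-j)`. -/

theorem exchange_eq_comp_swap [DecidableEq V] (x y : V) (ζ : Config V) :
    exchange x y ζ = ζ ∘ Equiv.swap x y := by
  funext z
  simp only [exchange, Function.comp, Equiv.swap_apply_def]
  split_ifs <;> simp_all

theorem exchange_exchange (x y : V) (ζ : Config V) : exchange x y (exchange x y ζ) = ζ := by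
  classical
  funext z
  simp [exchange_eq_comp_swap]

theorem exchange_self (x : V) (ζ : Config V) : exchange x x ζ = ζ := by
  classical
  funext z
  simp [exchange_eq_comp_swap]

/-- With the sites outside the range of `p` frozen, gradients between chosen sites become gradients
on the small index set. -/
theorem exchange_extend {ι : Type*} (p : ι → V) (hp : p.Injective) (i j : ι) (s : Config ι)
    (ζ : Config V) :
    exchange (p i) (p j) (Function.extend p s ζ) = Function.extend p (exchange i j s) ζ := by
  funext z
  by_cases h : ∃ k, p k = z
  · obtain ⟨k, rfl⟩ := h
    have h1 : ∀ l, p k = p l ↔ k = l := fun l => hp.eq_iff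
    simp only [exchange, hp.extend_apply]
    split_ifs <;> grind
  · have h1 : z ≠ p i := fun e => h ⟨i, e.symm⟩
    have h2 : z ≠ p j := fun e => h ⟨j, e.symm⟩
    simp [exchange, h1, h2, Function.extend_apply' _ _ _ h]

/-- The probability that a Bernoulli variable of parameter `α` takes the value `s`. -/
def bernoulliWeight (α : unitInterval) (s : Fin 2) : ℝ := if s = 1 then (α : ℝ) else 1 - α

theorem bernoulliWeight_nonneg (α : unitInterval) (s : Fin 2) : 0 ≤ bernoulliWeight α s := by
  unfold bernoulliWeight
  split_ifs
  · exact α.2.1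
  · linarith [α.2.2]

theorem sum_bernoulliWeight (α : unitInterval) : ∑ s, bernoulliWeight α s = 1 := by
  simp [bernoulliWeight, Fin.sum_univ_two]

variable [Fintype V]

theorem integral_bernoulliProduct [DecidableEq V] (α : unitInterval) (F : Config V → ℝ) :
    ∫ ζ, F ζ ∂(bernoulliProduct V α) = ∑ ζ, (∏ z, bernoulliWeight α (ζ z)) * F ζ := by
  unfold bernoulliProduct
  rw [integral_fintype .of_finite]
  refine Finset.sum_congr rfl fun ζ _ => ?_
  rw [smul_eq_mul, Measure.real, Measure.pi_singleton, ENNReal.toReal_prod]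
  congr 1
  refine Finset.prod_congr rfl fun z _ => ?_
  have h := ProbabilityTheory.bernoulliMeasure_real_apply (X := Fin 2) (x := 1) (y := 0) α
    (s := {ζ z}) (measurableSet_singleton _)
  rw [Measure.real] at h
  rw [h]
  generalize ζ z = s
  fin_cases s <;> simp [bernoulliWeight]

theorem integral_exchange (α : unitInterval) (x y : V) (F : Config V → ℝ) :
    ∫ ζ, F (exchange x y ζ) ∂(bernoulliProduct V α) = ∫ ζ, F ζ ∂(bernoulliProduct V α) := by
  classical
  simp only [integral_bernoulliProduct]
  refine Fintype.sum_equiv (Function.Involutive.toPerm (exchange x y) (exchange_exchange x y)) _ _ fun ζ => ?_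
  change _ = (∏ z, bernoulliWeight α (exchange x y ζ z)) * F (exchange x y ζ)
  congr 1
  rw [exchange_eq_comp_swap]
  exact (Equiv.prod_comp (Equiv.swap x y) fun z => bernoulliWeight α (ζ z)).symm

/-- The mean square gradient `ν_α[(∇_{xy} f)^2]`. -/
def gradEnergy (α : unitInterval) (f : Config V → ℝ) (x y : V) : ℝ :=
  ∫ ζ, (grad x y f ζ) ^ 2 ∂(bernoulliProduct V α)

theorem gradEnergy_nonneg (α : unitInterval) (f : Config V → ℝ) (x y : V) :
    0 ≤ gradEnergy α f x y :=
  integral_nonneg fun _ => sq_nonneg _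

theorem gradEnergy_comm (α : unitInterval) (f : Config V → ℝ) (x y : V) :
    gradEnergy α f x y = gradEnergy α f y x := by
  simp only [gradEnergy, grad, exchange_comm x y]

theorem gradEnergy_self (α : unitInterval) (f : Config V → ℝ) (x : V) :
    gradEnergy α f x x = 0 := by
  simp [gradEnergy, grad, exchange_self]

/-- Reversibility: averaging the integrand with its image under the exchange turns `f · (-∇f)` into
half a square. -/
theorem integral_mul_neg_grad (α : unitInterval) (f : Config V → ℝ) (x y : V) :
    ∫ ζ, f ζ * (-grad x y f ζ) ∂(bernoulliProduct V α) = gradEnergy α f x y / 2 := by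
  classical
  have h := integral_exchange α x y fun ζ => f ζ * (-grad x y f ζ)
  simp only [gradEnergy, integral_bernoulliProduct] at h ⊢
  have h2 : ∑ ζ, (∏ z, bernoulliWeight α (ζ z)) * (grad x y f ζ) ^ 2 =
      ∑ ζ, (∏ z, bernoulliWeight α (ζ z)) * (f ζ * (-grad x y f ζ)) +
      ∑ ζ, (∏ z, bernoulliWeight α (ζ z)) *
        (f (exchange x y ζ) * (-grad x y f (exchange x y ζ))) := by
    rw [← Finset.sum_add_distrib]
    refine Finset.sum_congr rfl fun ζ _ => ?_
    simp only [grad, exchange_exchange]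
    ring
  linarith

open Classical in
theorem dirichletEnergy_one (G : SimpleGraph V) (α : unitInterval) (f : Config V → ℝ) :
    dirichletEnergy G (fun _ => 1) α f = (∑ e ∈ G.edgeFinset,
      Sym2.lift ⟨gradEnergy α f, gradEnergy_comm α f⟩ e) / 2 := by
  have h : ∀ ζ, f ζ * (-generator G (fun _ => 1) f ζ) =
      ∑ e ∈ G.edgeFinset, f ζ * (-edgeGrad e f ζ) := fun ζ => by
    simp [generator, Finset.mul_sum]
  unfold dirichletEnergy
  simp only [h]
  rw [integral_finsetSum _ fun _ _ => by unfold bernoulliProduct; exact .of_finite,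
    Finset.sum_div]
  refine Finset.sum_congr rfl fun e _ => ?_
  induction e using Sym2.ind with
  | _ x y => exact integral_mul_neg_grad α f x y

/-- Resampling the occupation numbers at the sites `p i` leaves `ν_α` invariant. -/
theorem integral_resample {ι : Type*} [Fintype ι] [DecidableEq ι] (α : unitInterval) (p : ι → V)
    (hp : p.Injective) (F : Config V → ℝ) :
    ∫ ζ, F ζ ∂(bernoulliProduct V α) = ∫ ζ, (∑ s : Config ι, (∏ i, bernoulliWeight α (s i)) *
      F (Function.extend p s ζ)) ∂(bernoulliProduct V α) := by
  classical
  simp only [integral_bernoulliProduct]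
  -- Trading the values at the sites `p i` with an independent sample is an involution on pairs; by
  -- `hw` it preserves the product weight.
  have hinv : Function.Involutive fun q : Config V × Config ι =>
      (Function.extend p q.2 q.1, q.1 ∘ p) := by
    rintro ⟨ζ, s⟩
    refine Prod.ext (funext fun z => ?_) (funext fun i => ?_)
    · by_cases h : ∃ i, p i = z
      · obtain ⟨i, rfl⟩ := h
        simp [hp.extend_apply]
      · simp [Function.extend_apply' _ _ _ h]
    · simp [hp.extend_apply]
  have hw : ∀ (ζ : Config V) (s : Config ι),
      (∏ z, bernoulliWeight α (Function.extend p s ζ z)) * ∏ i, bernoulliWeight α (ζ (p i)) =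
        (∏ z, bernoulliWeight α (ζ z)) * ∏ i, bernoulliWeight α (s i) := fun ζ s => by
    have key : ∀ g : V → ℝ, ∏ z, g z =
        (∏ i, g (p i)) * ∏ z ∈ (Finset.univ.image p)ᶜ, g z := fun g => by
      rw [← Finset.prod_mul_prod_compl (Finset.univ.image p), Finset.prod_image hp.injOn]
    rw [key, key fun z => bernoulliWeight α (ζ z)]
    have hc : ∏ z ∈ (Finset.univ.image p)ᶜ, bernoulliWeight α (Function.extend p s ζ z) =
        ∏ z ∈ (Finset.univ.image p)ᶜ, bernoulliWeight α (ζ z) :=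
      Finset.prod_congr rfl fun z hz => by
        rw [Function.extend_apply']
        simpa using hz
    rw [hc]
    simp only [hp.extend_apply]
    ring
  have hone : ∑ s : Config ι, ∏ i, bernoulliWeight α (s i) = 1 := by
    have := (Finset.prod_univ_sum (fun _ : ι => (Finset.univ : Finset (Fin 2)))
      fun _ s => bernoulliWeight α s).symm
    simpa only [Fintype.piFinset_univ, sum_bernoulliWeight, Finset.prod_const_one] using this
  calc ∑ ζ, (∏ z, bernoulliWeight α (ζ z)) * F ζ
      = ∑ q : Config V × Config ι,
          (∏ z, bernoulliWeight α (q.1 z)) * (∏ i, bernoulliWeight α (q.2 i)) * F q.1 := by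
        rw [Fintype.sum_prod_type]
        refine Finset.sum_congr rfl fun ζ _ => ?_
        simp only
        rw [← Finset.sum_mul, ← Finset.mul_sum, hone, mul_one]
    _ = ∑ q : Config V × Config ι, (∏ z, bernoulliWeight α (q.1 z)) *
          (∏ i, bernoulliWeight α (q.2 i)) * F (Function.extend p q.2 q.1) := by
        refine Fintype.sum_equiv hinv.toPerm _ _ fun q => ?_
        have h2 : Function.extend p (q.1 ∘ p) (Function.extend p q.2 q.1) = q.1 :=
          congrArg Prod.fst (hinv q)
        simp only [Function.Involutive.coe_toPerm, h2, Function.comp, hw]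
    _ = _ := by
        rw [Fintype.sum_prod_type]
        refine Finset.sum_congr rfl fun ζ _ => ?_
        rw [Finset.mul_sum]
        exact Finset.sum_congr rfl fun s _ => by ring

/-! ### The star-mesh inequality for exclusion. -/

theorem sum_config_succ {n : ℕ} (F : Config (Fin (n + 1)) → ℝ) :
    ∑ s, F s = ∑ a, ∑ t : Config (Fin n), F (Matrix.vecCons a t) := by
  rw [← (Fin.consEquiv fun _ => Fin 2).sum_comp, Fintype.sum_prod_type]
  rfl

theorem sum_config_five (F : Config (Fin 5) → ℝ) :
    ∑ s, F s = ∑ a, ∑ b, ∑ c, ∑ d, ∑ e, F ![a, b, c, d, e] := by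
  simp only [sum_config_succ, Fintype.sum_unique]
  rfl

/-- The two-particle sector of the difference between a star with four legs, of conductances
`c i`, and its star-mesh transform, cleared of denominators. Here `u i` is the value at the
configuration `{hub, i}` and `v i j` the value at `{i, j}`. -/
def TwoParticleStarMesh (c1 c2 c3 c4 : ℝ) : Prop :=
  ∀ u1 u2 u3 u4 v12 v13 v14 v23 v24 v34 : ℝ,
    c1 * c2 * ((u1 - u2) ^ 2 + (v13 - v23) ^ 2 + (v14 - v24) ^ 2) +
    c1 * c3 * ((u1 - u3) ^ 2 + (v12 - v23) ^ 2 + (v14 - v34) ^ 2) +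
    c1 * c4 * ((u1 - u4) ^ 2 + (v12 - v24) ^ 2 + (v13 - v34) ^ 2) +
    c2 * c3 * ((u2 - u3) ^ 2 + (v12 - v13) ^ 2 + (v24 - v34) ^ 2) +
    c2 * c4 * ((u2 - u4) ^ 2 + (v12 - v14) ^ 2 + (v23 - v34) ^ 2) +
    c3 * c4 * ((u3 - u4) ^ 2 + (v13 - v14) ^ 2 + (v23 - v24) ^ 2) ≤
    (c1 + c2 + c3 + c4) *
      (c1 * ((u2 - v12) ^ 2 + (u3 - v13) ^ 2 + (u4 - v14) ^ 2) +
      c2 * ((u1 - v12) ^ 2 + (u3 - v23) ^ 2 + (u4 - v24) ^ 2) +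
      c3 * ((u1 - v13) ^ 2 + (u2 - v23) ^ 2 + (u4 - v34) ^ 2) +
      c4 * ((u1 - v14) ^ 2 + (u2 - v24) ^ 2 + (u3 - v34) ^ 2))

theorem twoParticleStarMesh_one_one_one_one : TwoParticleStarMesh 1 1 1 1 := by
  intro u1 u2 u3 u4 v12 v13 v14 v23 v24 v34
  -- The squares come from completing the square successively in `v34`, `v24`, `v23`, `v14`, `v13`,
  -- `v12`; no form in the `u i` is left over.
  linear_combination
    1/4 * sq_nonneg (-4*u3 - 4*u4 + v13 + v14 + v23 + v24 + 4*v34) +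
    1/60 * sq_nonneg (-16*u2 + 4*u3 - 12*u4 + 4*v12 - v13 + 3*v14 + 3*v23 + 15*v24) +
    2/45 * sq_nonneg (-8*u2 - 8*u3 + 4*u4 + 2*v12 + 2*v13 - v14 + 9*v23) +
    1/18 * sq_nonneg (-9*u1 + u2 + u3 - 5*u4 + 2*v12 + 2*v13 + 8*v14) +
    1/30 * sq_nonneg (-9*u1 + u2 - 7*u3 + 3*u4 + 2*v12 + 10*v13) +
    1/5 * sq_nonneg (-3*u1 - 3*u2 + u3 + u4 + 4*v12)

theorem twoParticleStarMesh_five_five_four_one : TwoParticleStarMesh 5 5 4 1 := by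
  intro u1 u2 u3 u4 v12 v13 v14 v23 v24 v34
  linear_combination
    1 * sq_nonneg (-3*u3 - 12*u4 + v13 + 4*v14 + v23 + 4*v24 + 5*v34) +
    1/20 * sq_nonneg (-15*u2 + 12*u3 - 27*u4 + 5*v12 - 4*v13 + 9*v14 + 20*v24) +
    1/5 * sq_nonneg (-15*u2 - 18*u3 + 3*u4 + 5*v12 + 6*v13 - v14 + 20*v23) +
    1/28 * sq_nonneg (-20*u1 + 5*u2 + 4*u3 - 19*u4 + 5*v12 + 4*v13 + 21*v14) +
    4/35 * sq_nonneg (-20*u1 + 5*u2 - 17*u3 + 2*u4 + 5*v12 + 25*v13) +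
    2/5 * sq_nonneg (-10*u1 - 10*u2 + 4*u3 + u4 + 15*v12)

theorem twoParticleStarMesh_two_one_two_zero : TwoParticleStarMesh 2 1 2 0 := by
  intro u1 u2 u3 u4 v12 v13 v14 v23 v24 v34
  -- As the fourth leg is absent, the first square already absorbs all of `v14`, `v24` and `v34`.
  linear_combination
    1 * sq_nonneg (-5*u4 + 2*v14 + v24 + 2*v34) +
    1/9 * sq_nonneg (-10*u2 - 5*u3 + 4*v12 + 2*v13 + 9*v23) +
    5/63 * sq_nonneg (-9*u1 + 2*u2 - 8*u3 + v12 + 14*v13) +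
    2/7 * sq_nonneg (-3*u1 - 4*u2 + 2*u3 + 5*v12)

/-- The star-mesh inequality in the mean for functions of five sites, of which site `0` is the hub. -/
theorem starMesh_local {c1 c2 c3 c4 : ℝ} (hc : TwoParticleStarMesh c1 c2 c3 c4)
    (w : Fin 2 → ℝ) (hw : ∀ s, 0 ≤ w s) (g : Config (Fin 5) → ℝ) :
    0 ≤ ∑ s : Config (Fin 5), (∏ i, w (s i)) *
      ((c1 + c2 + c3 + c4) * (c1 * grad 0 1 g s ^ 2 + c2 * grad 0 2 g s ^ 2 +
        c3 * grad 0 3 g s ^ 2 + c4 * grad 0 4 g s ^ 2) -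
      (c1 * c2 * grad 1 2 g s ^ 2 + c1 * c3 * grad 1 3 g s ^ 2 + c1 * c4 * grad 1 4 g s ^ 2 +
        c2 * c3 * grad 2 3 g s ^ 2 + c2 * c4 * grad 2 4 g s ^ 2 + c3 * c4 * grad 3 4 g s ^ 2)) := by
  have e01 : ∀ a b c d e : Fin 2, exchange 0 1 ![a, b, c, d, e] = ![b, a, c, d, e] := by
    intros; funext k; fin_cases k <;> simp [exchange]
  have e02 : ∀ a b c d e : Fin 2, exchange 0 2 ![a, b, c, d, e] = ![c, b, a, d, e] := by
    intros; funext k; fin_cases k <;> simp [exchange]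
  have e03 : ∀ a b c d e : Fin 2, exchange 0 3 ![a, b, c, d, e] = ![d, b, c, a, e] := by
    intros; funext k; fin_cases k <;> simp [exchange]
  have e04 : ∀ a b c d e : Fin 2, exchange 0 4 ![a, b, c, d, e] = ![e, b, c, d, a] := by
    intros; funext k; fin_cases k <;> simp [exchange]
  have e12 : ∀ a b c d e : Fin 2, exchange 1 2 ![a, b, c, d, e] = ![a, c, b, d, e] := by
    intros; funext k; fin_cases k <;> simp [exchange]
  have e13 : ∀ a b c d e : Fin 2, exchange 1 3 ![a, b, c, d, e] = ![a, d, c, b, e] := by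
    intros; funext k; fin_cases k <;> simp [exchange]
  have e14 : ∀ a b c d e : Fin 2, exchange 1 4 ![a, b, c, d, e] = ![a, e, c, d, b] := by
    intros; funext k; fin_cases k <;> simp [exchange]
  have e23 : ∀ a b c d e : Fin 2, exchange 2 3 ![a, b, c, d, e] = ![a, b, d, c, e] := by
    intros; funext k; fin_cases k <;> simp [exchange]
  have e24 : ∀ a b c d e : Fin 2, exchange 2 4 ![a, b, c, d, e] = ![a, b, e, d, c] := by
    intros; funext k; fin_cases k <;> simp [exchange]
  have e34 : ∀ a b c d e : Fin 2, exchange 3 4 ![a, b, c, d, e] = ![a, b, c, e, d] := by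
    intros; funext k; fin_cases k <;> simp [exchange]
  obtain ⟨G, hG⟩ : ∃ G : Fin 2 → Fin 2 → Fin 2 → Fin 2 → Fin 2 → ℝ,
    ∀ a b c d e, g ![a, b, c, d, e] = G a b c d e := ⟨_, fun _ _ _ _ _ => rfl⟩
  rw [sum_config_five]
  simp only [grad, e01, e02, e03, e04, e12, e13, e14, e23, e24, e34, hG, Fin.prod_univ_five,
    Fin.sum_univ_two, sub_self]
  -- Exchanges conserve the particle number, and the weight depends only on it, so each sector is
  -- treated alone; those with 0 or 5 particles contribute nothing.
  have h2 := mul_nonneg (mul_nonneg (pow_nonneg (hw 1) 2) (pow_nonneg (hw 0) 3))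
    (sub_nonneg.2 (hc (G 1 1 0 0 0) (G 1 0 1 0 0) (G 1 0 0 1 0) (G 1 0 0 0 1) (G 0 1 1 0 0)
      (G 0 1 0 1 0) (G 0 1 0 0 1) (G 0 0 1 1 0) (G 0 0 1 0 1) (G 0 0 0 1 1)))
  -- Three particles are two holes: the same form at the complementary configurations.
  have h3 := mul_nonneg (mul_nonneg (pow_nonneg (hw 1) 3) (pow_nonneg (hw 0) 2))
    (sub_nonneg.2 (hc (G 0 0 1 1 1) (G 0 1 0 1 1) (G 0 1 1 0 1) (G 0 1 1 1 0) (G 1 0 0 1 1)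
      (G 1 0 1 0 1) (G 1 0 1 1 0) (G 1 1 0 0 1) (G 1 1 0 1 0) (G 1 1 1 0 0)))
  -- For one particle, the star minus its mesh is the square of the net current out of the hub.
  have h1 := mul_nonneg (mul_nonneg (pow_nonneg (hw 1) 1) (pow_nonneg (hw 0) 4))
    (sq_nonneg (c1 * (G 1 0 0 0 0 - G 0 1 0 0 0) + c2 * (G 1 0 0 0 0 - G 0 0 1 0 0) +
      c3 * (G 1 0 0 0 0 - G 0 0 0 1 0) + c4 * (G 1 0 0 0 0 - G 0 0 0 0 1)))
  have h4 := mul_nonneg (mul_nonneg (pow_nonneg (hw 1) 4) (pow_nonneg (hw 0) 1))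
    (sq_nonneg (c1 * (G 0 1 1 1 1 - G 1 0 1 1 1) + c2 * (G 0 1 1 1 1 - G 1 1 0 1 1) +
      c3 * (G 0 1 1 1 1 - G 1 1 1 0 1) + c4 * (G 0 1 1 1 1 - G 1 1 1 1 0)))
  simp only [Matrix.cons_val_zero, Matrix.cons_val_one, Matrix.cons_val]
  -- The factor 2 arises because each pair of configurations related by an exchange is met from both
  -- ends.
  linear_combination 2 * h1 + 2 * h2 + 2 * h3 + 2 * h4

/-- The star-mesh (octopus) inequality for the exclusion process, for a hub `p 0` with four legs. -/
theorem starMesh {c1 c2 c3 c4 : ℝ} (hc : TwoParticleStarMesh c1 c2 c3 c4) (α : unitInterval)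
    (f : Config V → ℝ) (p : Fin 5 → V) (hp : p.Injective) :
    c1 * c2 * gradEnergy α f (p 1) (p 2) + c1 * c3 * gradEnergy α f (p 1) (p 3) +
    c1 * c4 * gradEnergy α f (p 1) (p 4) + c2 * c3 * gradEnergy α f (p 2) (p 3) +
    c2 * c4 * gradEnergy α f (p 2) (p 4) + c3 * c4 * gradEnergy α f (p 3) (p 4) ≤
    (c1 + c2 + c3 + c4) *
      (c1 * gradEnergy α f (p 0) (p 1) + c2 * gradEnergy α f (p 0) (p 2) +
      c3 * gradEnergy α f (p 0) (p 3) + c4 * gradEnergy α f (p 0) (p 4)) := by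
  have hgrad : ∀ (i j : Fin 5) (s : Config (Fin 5)) (ζ : Config V),
      grad (p i) (p j) f (Function.extend p s ζ) =
        grad i j (fun t => f (Function.extend p t ζ)) s := fun i j s ζ => by
    simp only [grad, exchange_extend p hp]
  have key := integral_resample α p hp fun ζ =>
      ((c1 + c2 + c3 + c4) * (c1 * grad (p 0) (p 1) f ζ ^ 2 + c2 * grad (p 0) (p 2) f ζ ^ 2 +
        c3 * grad (p 0) (p 3) f ζ ^ 2 + c4 * grad (p 0) (p 4) f ζ ^ 2) -
      (c1 * c2 * grad (p 1) (p 2) f ζ ^ 2 + c1 * c3 * grad (p 1) (p 3) f ζ ^ 2 +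
        c1 * c4 * grad (p 1) (p 4) f ζ ^ 2 + c2 * c3 * grad (p 2) (p 3) f ζ ^ 2 +
        c2 * c4 * grad (p 2) (p 4) f ζ ^ 2 + c3 * c4 * grad (p 3) (p 4) f ζ ^ 2))
  have hnn : 0 ≤ ∫ ζ, ((c1 + c2 + c3 + c4) * (c1 * grad (p 0) (p 1) f ζ ^ 2 +
        c2 * grad (p 0) (p 2) f ζ ^ 2 +
        c3 * grad (p 0) (p 3) f ζ ^ 2 + c4 * grad (p 0) (p 4) f ζ ^ 2) -
      (c1 * c2 * grad (p 1) (p 2) f ζ ^ 2 + c1 * c3 * grad (p 1) (p 3) f ζ ^ 2 +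
        c1 * c4 * grad (p 1) (p 4) f ζ ^ 2 + c2 * c3 * grad (p 2) (p 3) f ζ ^ 2 +
        c2 * c4 * grad (p 2) (p 4) f ζ ^ 2 + c3 * c4 * grad (p 3) (p 4) f ζ ^ 2))
        ∂(bernoulliProduct V α) := by
    rw [key]
    refine integral_nonneg fun ζ => ?_
    simp only [hgrad]
    exact starMesh_local hc _ (bernoulliWeight_nonneg α) _
  classical
  simp only [integral_bernoulliProduct, gradEnergy] at hnn ⊢
  rw [← sub_nonneg]
  refine hnn.trans_eq ?_
  simp only [Finset.mul_sum, ← Finset.sum_add_distrib, ← Finset.sum_sub_distrib]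
  exact Finset.sum_congr rfl fun ζ _ => by ring

/-- The energy of a once subdivided triangle, with corners `p 0`, `p 1`, `p 2` and `p 3`, `p 4`,
`p 5` the midpoints of `p 0 p 1`, `p 1 p 2`, `p 2 p 0`, controls that of the triangle. -/
theorem three_fifths_triangle_le (α : unitInterval) (f : Config V → ℝ) (p : Fin 6 → V)
    (hp : p.Injective) :
    3 / 5 * (gradEnergy α f (p 0) (p 1) + gradEnergy α f (p 1) (p 2) +
      gradEnergy α f (p 2) (p 0)) ≤
    (gradEnergy α f (p 0) (p 3) + gradEnergy α f (p 3) (p 5) + gradEnergy α f (p 5) (p 0)) +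
    (gradEnergy α f (p 3) (p 1) + gradEnergy α f (p 1) (p 4) + gradEnergy α f (p 4) (p 3)) +
    (gradEnergy α f (p 5) (p 4) + gradEnergy α f (p 4) (p 2) + gradEnergy α f (p 2) (p 5)) := by
  -- Eliminating `p 3` (four unit legs) adds `1/4` to each pair among `p 0`, `p 1`, `p 4`, `p 5`.
  have hA := starMesh twoParticleStarMesh_one_one_one_one α f (p ∘ ![3, 0, 1, 4, 5])
    (hp.comp (by decide))
  -- The legs at `p 4` are now `5/4, 5/4, 1, 1/4`, proportional to `5, 5, 4, 1`.
  have hB := starMesh twoParticleStarMesh_five_five_four_one α f (p ∘ ![4, 1, 5, 2, 0])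
    (hp.comp (by decide))
  -- The legs at `p 5` are now `4/3, 2/3, 4/3`, proportional to `2, 1, 2`; the fourth, of
  -- conductance 0, ends at the already eliminated `p 3`. What remains is `3/5` on each side.
  have hC := starMesh twoParticleStarMesh_two_one_two_zero α f (p ∘ ![5, 0, 1, 2, 3])
    (hp.comp (by decide))
  simp only [Function.comp, Matrix.cons_val_zero, Matrix.cons_val_one, Matrix.cons_val] at hA hB hC
  have h := gradEnergy_comm α f
  rw [h (p 3) (p 0)] at hA
  rw [h (p 4) (p 1), h (p 4) (p 0), h (p 1) (p 0), h (p 5) (p 2)] at hB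
  rw [h (p 5) (p 1), h (p 5) (p 2), h (p 0) (p 2)] at hC
  rw [h (p 4) (p 3), h (p 5) (p 4)]
  rw [h (p 5) (p 0)] at hB hC ⊢
  linarith

end Exclusion

namespace SierpinskiGasket

/-! ### Cells of the gasket and their energies. -/

variable (a : Fin 3 → Plane)

theorem contraction_self (i : Fin 3) : contraction a i (a i) = a i := by
  simp [contraction]

theorem contraction_swap (i j : Fin 3) : contraction a i (a j) = contraction a j (a i) := by
  simp only [contraction]
  module

theorem wordMap_nil (x : Plane) : wordMap a [] x = x := rfl

theorem wordMap_injective (w : List (Fin 3)) : (wordMap a w).Injective := by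
  induction w with
  | nil => exact Function.injective_id
  | cons i w ih => exact (contraction_injective a i).comp ih

theorem mem_verts_succ {N : ℕ} {x : Plane} :
    x ∈ (graph a (N + 1)).verts ↔ ∃ i, ∃ y ∈ (graph a N).verts, contraction a i y = x := by
  simp [graph, contractionHom, Fin.exists_fin_succ, or_assoc]

theorem verts_subset_succ (N : ℕ) : (graph a N).verts ⊆ (graph a (N + 1)).verts := by
  induction N with
  | zero =>
    rintro _ ⟨i, rfl⟩
    exact (mem_verts_succ a).2 ⟨i, a i, ⟨i, rfl⟩, contraction_self a i⟩
  | succ N ih =>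
    intro x hx
    obtain ⟨i, y, hy, rfl⟩ := (mem_verts_succ a).1 hx
    exact (mem_verts_succ a).2 ⟨i, y, ih hy, rfl⟩

theorem verts_mono : Monotone fun N => (graph a N).verts :=
  monotone_nat_of_le_succ (verts_subset_succ a)

theorem wordMap_mem_verts {N : ℕ} (w : List (Fin 3)) {x : Plane} (hx : x ∈ (graph a N).verts) :
    wordMap a w x ∈ (graph a (w.length + N)).verts := by
  induction w with
  | nil => simpa [wordMap_nil] using hx
  | cons i w ih =>
    rw [List.length_cons, Nat.add_right_comm]
    exact (mem_verts_succ a).2 ⟨i, _, ih, rfl⟩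

/-- The sum of `X` over the three edges of every level-`N` cell. -/
def cellEnergy : ℕ → (Plane → Plane → ℝ) → ℝ
  | 0, X => X (a 0) (a 1) + X (a 1) (a 2) + X (a 2) (a 0)
  | N + 1, X => ∑ i, cellEnergy N fun x y => X (contraction a i x) (contraction a i y)

theorem cellEnergy_nonneg (N : ℕ) (X : Plane → Plane → ℝ) (hX : ∀ x y, 0 ≤ X x y) :
    0 ≤ cellEnergy a N X := by
  induction N generalizing X with
  | zero => exact add_nonneg (add_nonneg (hX _ _) (hX _ _)) (hX _ _)
  | succ N ih => exact Finset.sum_nonneg fun i _ => ih _ fun _ _ => hX _ _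

/-- A pair of corners is an edge of its cell or degenerate, and all the other terms of the sum are
nonnegative. -/
theorem le_cellEnergy (w : List (Fin 3)) (X : Plane → Plane → ℝ) (hX : ∀ x y, 0 ≤ X x y)
    (hcomm : ∀ x y, X x y = X y x) (hself : ∀ x, X x x = 0) (i j : Fin 3) :
    X (wordMap a w (a i)) (wordMap a w (a j)) ≤ cellEnergy a w.length X := by
  induction w generalizing X with
  | nil =>
    simp only [wordMap_nil, List.length_nil, cellEnergy]
    have h01 := hX (a 0) (a 1)
    have h12 := hX (a 1) (a 2)
    have h20 := hX (a 2) (a 0)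
    have c01 := hcomm (a 0) (a 1)
    have c12 := hcomm (a 1) (a 2)
    have c20 := hcomm (a 2) (a 0)
    fin_cases i <;> fin_cases j <;> simp only [Fin.zero_eta, Fin.mk_one, Fin.reduceFinMk, hself] <;>
      linarith
  | cons k w ih =>
    refine (ih (fun x y => X (contraction a k x) (contraction a k y)) (fun _ _ => hX _ _)
      (fun _ _ => hcomm _ _) fun _ => hself _).trans ?_
    exact Finset.single_le_sum
      (f := fun i => cellEnergy a w.length fun x y => X (contraction a i x) (contraction a i y))
      (fun i _ => cellEnergy_nonneg a _ _ fun _ _ => hX _ _) (Finset.mem_univ k)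

/-- A local comparison in each level-`N` cell yields a comparison of consecutive levels. -/
theorem three_fifths_cellEnergy_le (N : ℕ) (X : Plane → Plane → ℝ)
    (h : ∀ w : List (Fin 3), w.length = N →
      3 / 5 * cellEnergy a 0 (fun x y => X (wordMap a w x) (wordMap a w y)) ≤
        cellEnergy a 1 fun x y => X (wordMap a w x) (wordMap a w y)) :
    3 / 5 * cellEnergy a N X ≤ cellEnergy a (N + 1) X := by
  induction N generalizing X with
  | zero => exact h [] rfl
  | succ N ih =>
    rw [cellEnergy, Finset.mul_sum, cellEnergy]
    exact Finset.sum_le_sum fun i _ => ih _ fun w hw => h (i :: w) (by simp [hw])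

/-! ### Geometry of the nondegenerate triangle. -/

variable {a}

/-- The corners of the triangle followed by the midpoints of its sides. -/
def subdivision (a : Fin 3 → Plane) : Fin 6 → Plane :=
  ![a 0, a 1, a 2, contraction a 0 (a 1), contraction a 1 (a 2), contraction a 2 (a 0)]

theorem subdivision_mem_verts (k : Fin 6) : subdivision a k ∈ (graph a 1).verts := by
  have h : ∀ i j, contraction a i (a j) ∈ (graph a 1).verts := fun i j =>
    (mem_verts_succ a).2 ⟨i, a j, ⟨j, rfl⟩, rfl⟩
  have h0 : ∀ i, a i ∈ (graph a 1).verts := fun i => verts_subset_succ a 0 ⟨i, rfl⟩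
  fin_cases k
  exacts [h0 0, h0 1, h0 2, h 0 1, h 1 2, h 2 0]

/-- Barycentric coordinates with respect to a nondegenerate triangle. -/
theorem exists_barycentric (ha : AffineIndependent ℝ a) :
    ∃ b : Fin 3 → Plane → ℝ, (∀ x y, (∀ k, b k x = b k y) → x = y) ∧ (∀ x, ∑ k, b k x = 1) ∧
      (∀ i k, b k (a i) = if k = i then 1 else 0) ∧
      ∀ i k x, b k (contraction a i x) = (b k x + if k = i then 1 else 0) / 2 := by
  have htop : affineSpan ℝ (Set.range a) = ⊤ :=
    ha.affineSpan_eq_top_iff_card_eq_finrank_add_one.2 (by simp)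
  let B : AffineBasis (Fin 3) ℝ Plane := ⟨a, ha, htop⟩
  have hB : ∀ i k, B.coord k (a i) = if k = i then 1 else 0 := fun i k => B.coord_apply k i
  refine ⟨fun k x => B.coord k x, fun x y h => ?_, B.sum_coord_apply_eq_one, hB, fun i k x => ?_⟩
  · rw [← B.linear_combination_coord_eq_self x, ← B.linear_combination_coord_eq_self y]
    exact Finset.sum_congr rfl fun k _ => congrArg (· • B k) (h k)
  · have h1 : contraction a i x = AffineMap.lineMap (a i) x (1 / 2 : ℝ) := by
      simp [contraction, AffineMap.lineMap_apply]
    have h2 : B.coord k (AffineMap.lineMap (a i) x (1 / 2 : ℝ)) =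
        AffineMap.lineMap (B.coord k (a i)) (B.coord k x) (1 / 2 : ℝ) :=
      AffineMap.apply_lineMap _ _ _ _
    beta_reduce
    rw [h1, h2, hB]
    simp only [AffineMap.lineMap_apply_module, smul_eq_mul]
    ring

theorem subdivision_injective (ha : AffineIndependent ℝ a) : (subdivision a).Injective := by
  obtain ⟨b, -, -, hb, hc⟩ := exists_barycentric ha
  -- Two barycentric coordinates already separate the six points.
  have h0 : ∀ k, b 0 (subdivision a k) = (![1, 0, 0, 1 / 2, 0, 1 / 2] : Fin 6 → ℝ) k := by
    intro k
    fin_cases k <;> simp [subdivision, hb, hc]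
  have h1 : ∀ k, b 1 (subdivision a k) = (![0, 1, 0, 1 / 2, 1 / 2, 0] : Fin 6 → ℝ) k := by
    intro k
    fin_cases k <;> simp [subdivision, hb, hc]
  intro k l hkl
  have e0 := h0 k
  have e1 := h1 k
  rw [hkl, h0] at e0
  rw [hkl, h1] at e1
  fin_cases k <;> fin_cases l <;> first | rfl | (exfalso; revert e0 e1; norm_num)

theorem barycentric_nonneg {b : Fin 3 → Plane → ℝ}
    (hb : ∀ i k, b k (a i) = if k = i then 1 else 0)
    (hc : ∀ i k x, b k (contraction a i x) = (b k x + if k = i then 1 else 0) / 2)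
    {N : ℕ} {x : Plane} (hx : x ∈ (graph a N).verts) (k : Fin 3) : 0 ≤ b k x := by
  induction N generalizing x with
  | zero =>
    obtain ⟨i, rfl⟩ := hx
    rw [hb]
    split_ifs <;> norm_num
  | succ N ih =>
    obtain ⟨i, y, hy, rfl⟩ := (mem_verts_succ a).1 hx
    have := ih hy
    rw [hc]
    split_ifs <;> linarith

/-- Distinct level-`1` cells overlap in at most one point. -/
theorem eq_of_mem_two_cells (ha : AffineIndependent ℝ a) {N : ℕ} {i j : Fin 3} (hij : i ≠ j)
    {x y : Plane} (hxi : ∃ x' ∈ (graph a N).verts, contraction a i x' = x)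
    (hxj : ∃ x' ∈ (graph a N).verts, contraction a j x' = x)
    (hyi : ∃ y' ∈ (graph a N).verts, contraction a i y' = y)
    (hyj : ∃ y' ∈ (graph a N).verts, contraction a j y' = y) : x = y := by
  obtain ⟨b, hinj, hsum, hb, hc⟩ := exists_barycentric ha
  have hge : ∀ (l : Fin 3) (z : Plane), (∃ z' ∈ (graph a N).verts, contraction a l z' = z) →
      (∀ k, 0 ≤ b k z) ∧ 1 / 2 ≤ b l z := by
    rintro l _ ⟨z, hz, rfl⟩
    have h := barycentric_nonneg hb hc hz
    refine ⟨fun k => ?_, ?_⟩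
    · have := h k
      rw [hc]
      split_ifs <;> linarith
    · have := h l
      rw [hc, if_pos rfl]
      linarith
  -- Points of cell `i` have `i`-th coordinate at least `1/2`. In two cells at once, nonnegativity
  -- and total 1 force the midpoint of `a i` and `a j`.
  have key : ∀ z, (∃ z' ∈ (graph a N).verts, contraction a i z' = z) →
      (∃ z' ∈ (graph a N).verts, contraction a j z' = z) →
      ∀ k, b k z = if k = i ∨ k = j then 1 / 2 else 0 := by
    intro z hi hj k
    obtain ⟨hnn, h1⟩ := hge i z hi
    have h2 := (hge j z hj).2
    have hs := hsum z
    rw [Fin.sum_univ_three] at hs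
    have n0 := hnn 0
    have n1 := hnn 1
    have n2 := hnn 2
    fin_cases i <;> fin_cases j <;> fin_cases k <;> simp at hij h1 h2 ⊢ <;> linarith
  exact hinj x y fun k => (key x hxi hxj k).trans (key y hyi hyj k).symm

/-! ### Edges of the graph as edges of cells. -/

theorem edgeSet_succ (N : ℕ) : (graph a (N + 1)).edgeSet =
    ⋃ i, Sym2.map (contraction a i) '' (graph a N).edgeSet := by
  simp only [graph, SimpleGraph.Subgraph.edgeSet_iSup, SimpleGraph.Subgraph.edgeSet_map]
  rfl

theorem finite_edgeSet (N : ℕ) : (graph a N).edgeSet.Finite := by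
  rw [← SimpleGraph.Subgraph.image_coe_edgeSet_coe]
  exact (Set.toFinite _).image _

theorem edgeSet_zero (ha : AffineIndependent ℝ a) :
    (graph a 0).edgeSet = {s(a 0, a 1), s(a 1, a 2), s(a 2, a 0)} := by
  have hadj : ∀ x y, (graph a 0).Adj x y ↔ x ∈ Set.range a ∧ y ∈ Set.range a ∧ x ≠ y := by
    intro x y
    simp [graph, SimpleGraph.Subgraph.induce]
  ext e
  induction e using Sym2.ind with
  | _ x y =>
    rw [SimpleGraph.Subgraph.mem_edgeSet, hadj]
    constructor
    · rintro ⟨⟨i, rfl⟩, ⟨j, rfl⟩, hij⟩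
      fin_cases i <;> fin_cases j <;> simp_all [Sym2.eq_swap]
    · have h01 : a 0 ≠ a 1 := ha.injective.ne (by decide)
      have h12 : a 1 ≠ a 2 := ha.injective.ne (by decide)
      have h20 : a 2 ≠ a 0 := ha.injective.ne (by decide)
      rintro (h | h | h) <;> rcases Sym2.eq_iff.1 h with ⟨rfl, rfl⟩ | ⟨rfl, rfl⟩ <;>
        simp [h01, h12, h20, h01.symm, h12.symm, h20.symm]

/-- Every edge lies in just one cell, so summing cell by cell counts each edge once, as the
Dirichlet energy does. -/
theorem cellEnergy_eq_finsum (ha : AffineIndependent ℝ a) (N : ℕ) (X : Plane → Plane → ℝ)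
    (hcomm : ∀ x y, X x y = X y x) :
    cellEnergy a N X = ∑ᶠ e ∈ (graph a N).edgeSet, Sym2.lift ⟨X, hcomm⟩ e := by
  induction N generalizing X with
  | zero =>
    rw [edgeSet_zero ha, finsum_mem_insert _ _ (Set.toFinite _), finsum_mem_pair]
    · simp [cellEnergy, add_assoc]
    · simp [ha.injective.eq_iff]
    · simp [ha.injective.eq_iff]
  | succ N ih =>
    rw [edgeSet_succ, finsum_mem_iUnion, finsum_eq_sum_of_fintype, cellEnergy]
    · refine Finset.sum_congr rfl fun i _ => ?_
      rw [finsum_mem_image (Sym2.map.injective (contraction_injective a i)).injOn,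
        ih _ fun _ _ => hcomm _ _]
      refine finsum_mem_congr rfl fun e _ => ?_
      induction e using Sym2.ind with
      | _ x y => rfl
    · intro i j hij
      refine Set.disjoint_left.2 ?_
      rintro _ ⟨e, he, rfl⟩ ⟨e', he', h⟩
      induction e using Sym2.ind with
      | _ x y =>
      induction e' using Sym2.ind with
      | _ x' y' =>
      have hx := (graph a N).edge_vert he
      have hy := (graph a N).edge_vert he.symm
      have hx' := (graph a N).edge_vert he'
      have hy' := (graph a N).edge_vert he'.symm
      -- A shared edge would have both of its endpoints in two distinct cells, which meet in at most
      -- one point.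
      refine ((graph a N).adj_sub he).ne (contraction_injective a i ?_)
      rcases Sym2.eq_iff.1 h with ⟨h1, h2⟩ | ⟨h1, h2⟩
      · exact eq_of_mem_two_cells ha hij ⟨x, hx, rfl⟩ ⟨x', hx', h1⟩ ⟨y, hy, rfl⟩ ⟨y', hy', h2⟩
      · exact eq_of_mem_two_cells ha hij ⟨x, hx, rfl⟩ ⟨y', hy', h2⟩ ⟨y, hy, rfl⟩ ⟨x', hx', h1⟩
    · exact fun i => (finite_edgeSet N).image _

open Classical in
/-- The mean square gradient along a pair of points of the plane, zero off the vertex set. -/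
def planeGradEnergy {N : ℕ} (α : unitInterval) (f : Exclusion.Config (graph a N).verts → ℝ)
    (x y : Plane) : ℝ :=
  if h : x ∈ (graph a N).verts ∧ y ∈ (graph a N).verts then
    Exclusion.gradEnergy α f ⟨x, h.1⟩ ⟨y, h.2⟩ else 0

/-! ### Comparison of the energies of consecutive levels. -/

section

variable {N : ℕ} (α : unitInterval) (f : Exclusion.Config (graph a N).verts → ℝ)

theorem planeGradEnergy_coe (x y : (graph a N).verts) :
    planeGradEnergy α f x y = Exclusion.gradEnergy α f x y := by
  simp [planeGradEnergy]

theorem planeGradEnergy_nonneg (x y : Plane) : 0 ≤ planeGradEnergy α f x y := by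
  unfold planeGradEnergy
  split_ifs
  exacts [Exclusion.gradEnergy_nonneg _ _ _ _, le_rfl]

theorem planeGradEnergy_comm (x y : Plane) :
    planeGradEnergy α f x y = planeGradEnergy α f y x := by
  unfold planeGradEnergy
  by_cases hx : x ∈ (graph a N).verts <;> by_cases hy : y ∈ (graph a N).verts <;>
    simp [hx, hy, Exclusion.gradEnergy_comm α f ⟨x, _⟩]

theorem planeGradEnergy_self (x : Plane) : planeGradEnergy α f x x = 0 := by
  unfold planeGradEnergy
  split_ifs
  exacts [Exclusion.gradEnergy_self _ _ _, rfl]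

theorem cellEnergy_planeGradEnergy (ha : AffineIndependent ℝ a) :
    cellEnergy a N (planeGradEnergy α f) =
      2 * Exclusion.dirichletEnergy (graph a N).coe (fun _ => 1) α f := by
  classical
  rw [cellEnergy_eq_finsum ha N _ (planeGradEnergy_comm α f), Exclusion.dirichletEnergy_one,
    ← SimpleGraph.Subgraph.image_coe_edgeSet_coe,
    finsum_mem_image (Sym2.map.injective Subtype.val_injective).injOn, mul_div_cancel₀ _ two_ne_zero,
    ← SimpleGraph.coe_edgeFinset, finsum_mem_coe_finset]
  refine Finset.sum_congr (by congr!) fun e _ => ?_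
  induction e using Sym2.ind with
  | _ x y => exact planeGradEnergy_coe α f x y

theorem three_fifths_cellEnergy_planeGradEnergy_le (ha : AffineIndependent ℝ a) {M : ℕ}
    (hM : M + 1 ≤ N) : 3 / 5 * cellEnergy a M (planeGradEnergy α f) ≤
      cellEnergy a (M + 1) (planeGradEnergy α f) := by
  refine three_fifths_cellEnergy_le a M _ fun w hw => ?_
  -- The six points lie in `V_{M+1} ⊆ V_N`, so the default value 0 of `planeGradEnergy` is never
  -- used.
  have hmem : ∀ k, wordMap a w (subdivision a k) ∈ (graph a N).verts := fun k =>
    verts_mono a (hw ▸ hM) (wordMap_mem_verts a w (subdivision_mem_verts k))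
  have h := Exclusion.three_fifths_triangle_le α f (fun k => ⟨_, hmem k⟩) fun k l hkl =>
    subdivision_injective ha (wordMap_injective a w (congrArg Subtype.val hkl))
  simp only [← planeGradEnergy_coe] at h
  -- Each midpoint arises from two of the contractions; one name is chosen for each.
  simp only [cellEnergy, Fin.sum_univ_three, contraction_self, contraction_swap a 1 0,
    contraction_swap a 2 1, contraction_swap a 0 2]
  exact h

theorem cellEnergy_planeGradEnergy_le (ha : AffineIndependent ℝ a) {j : ℕ} (hj : j ≤ N) :
    cellEnergy a j (planeGradEnergy α f) ≤
      (5 / 3) ^ (N - j) * cellEnergy a N (planeGradEnergy α f) := by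
  induction hd : N - j generalizing j with
  | zero =>
    obtain rfl : j = N := by omega
    simp
  | succ d ih =>
    have h1 := three_fifths_cellEnergy_planeGradEnergy_le α f ha (M := j) (by omega)
    have h2 := ih (j := j + 1) (by omega) (by omega)
    rw [pow_succ]
    linarith

end

end SierpinskiGasket

end

theorem proposition1p3 (a : Fin 3 → SierpinskiGasket.Plane) (ha : AffineIndependent ℝ a) :
    ∃ C : ℝ, 0 < C ∧
      ∀ (N j : ℕ), j ≤ N →
      ∀ (α : unitInterval) (x y : (SierpinskiGasket.graph a N).verts),
        SierpinskiGasket.SameCell a j (x : SierpinskiGasket.Plane) (y : SierpinskiGasket.Plane) →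
      ∀ f : Exclusion.Config (SierpinskiGasket.graph a N).verts → ℝ,
        ∫ ζ, (Exclusion.grad x y f ζ) ^ 2
            ∂(Exclusion.bernoulliProduct (SierpinskiGasket.graph a N).verts α) ≤
          C * (5 / 3 : ℝ) ^ (N - j) *
            Exclusion.dirichletEnergy (SierpinskiGasket.graph a N).coe (fun _ => 1) α f := by
  -- The constant 2 undoes the factor `1/2` between the Dirichlet energy and the sum of mean square
  -- gradients over edges.
  refine ⟨2, two_pos, ?_⟩
  rintro N j hj α x y ⟨w, rfl, ⟨_, ⟨i, rfl⟩, hx⟩, ⟨_, ⟨k, rfl⟩, hy⟩⟩ f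
  change Exclusion.gradEnergy α f x y ≤ _
  have h1 := SierpinskiGasket.le_cellEnergy a w (SierpinskiGasket.planeGradEnergy α f)
    (SierpinskiGasket.planeGradEnergy_nonneg α f) (SierpinskiGasket.planeGradEnergy_comm α f)
    (SierpinskiGasket.planeGradEnergy_self α f) i k
  rw [hx, hy, SierpinskiGasket.planeGradEnergy_coe] at h1
  have h2 := SierpinskiGasket.cellEnergy_planeGradEnergy_le α f ha hj
  rw [SierpinskiGasket.cellEnergy_planeGradEnergy α f ha] at h2
  linarith
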